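/- Let $E_1=\mathbb C/\pi_1(E_1)$ and $E_2=\mathbb C/\pi_1(E_2)$ be elliptic curves, where $\pi_1(E_i)\subset\mathbb C$ is the period lattice (the fundamental group acting on the universal cover $\mathbb C$). Let $F\subset E_1\times E_2$ be an elliptic curve on $E_1 \times E_2$ (the image of a holomorphic embedding of some elliptic curve $\mathbb C/\Lambda$) passing through the origin. Then: (i) there is a vector $(a,b)\in\mathbb C^2\setminus\{(0,0)\}$, called a slope vector of $F$, such that $$F=\{(at+\pi_1(E_1),\,bt+\pi_1(E_2)) \mid t\in\mathbb C\}.$$ Moreover, for every $(a,b)\in\mathbb C^2\setminus\{(0,0)\}$ for which this equality holds: (ii) the fundamental group of $F$, identified with the group of periods of the universal covering $\mathbb C\to F$, $t\mapsto(at+\pi_1(E_1),bt+\pi_1(E_2))$, is $$\pi_1(F)=\begin{cases} a^{-1}\pi_1(E_1)\cap b^{-1}\pi_1(E_2) & \text{if } a\ne0,\ b\neq 0,\\ a^{-1}\pi_1(E_1) & \text{if } a\neq 0,\ b=0,\\ b^{-1}\pi_1(E_2) & \text{if } a=0,\ b\neq 0.\end{cases}$$ That is, the right-hand side $P$ is a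 lattice of $\mathbb C$, the map above induces a holomorphic embedding $\mathbb C/P\to E_1\times E_2$ with image $F$, and sending $m\in P$ to the class of the loop $s\mapsto (asm+\pi_1(E_1),bsm+\pi_1(E_2))$, $0\le s\le 1$, is an isomorphism of $P$ onto the topological fundamental group of $F$ based at the origin; (iii) $a\pi_1(E_2)+b\pi_1(E_1)$ is a lattice of $\mathbb C$, so that $F'=\mathbb C/(a\pi_1(E_2)+b\pi_1(E_1))$ is an elliptic curve, and $$\psi_{(a,b)}:E_1\times E_2\to F',\qquad \psi_{(a,b)}(u+\pi_1(E_1),v+\pi_1(E_2))=bu-av+a\pi_1(E_2)+b\pi_1(E_1),$$ is a well-defined surjective group homomorphism and a holomorphic submersion. Its kernel is $$\ker\psi_{(a,b)}=F=\{(u+\pi_1(E_1),v+\pi_1(E_2)) \mid bu-av\in a\pi_1(E_2)+b\pi_1(E_1)\},$$ and for every point $x \in E_1\times E_2$ the fibre of $\psi_{(a,b)}$ through $x$ is the translate $F+x$, which is an elliptic curve on $E_1 \times E_2$. -/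

import Mathlib

open Topology Pointwise

noncomputable section

/-- `Λ` is a lattice of `(ℂ, +)`: a discrete subgroup spanning `ℂ` over `ℝ`. -/
def IsComplexLattice (Λ : Submodule ℤ ℂ) : Prop :=
  ∃ _ : DiscreteTopology Λ, IsZLattice ℝ Λ

/-- The elliptic curve `E = ℂ / π₁(E)` whose fundamental group, viewed as the group of periods of
its universal covering `ℂ → E`, is the lattice `Λ`. -/
abbrev EllCurve (Λ : Submodule ℤ ℂ) : Type := ℂ ⧸ Λ

/-- The universal covering `ℂ → ℂ / Λ`. -/
def curveProj (Λ : Submodule ℤ ℂ) : ℂ → EllCurve Λ := fun t => Submodule.Quotient.mk t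

/-- The universal covering `ℂ² → E₁ × E₂`. -/
def surfProj (Λ₁ Λ₂ : Submodule ℤ ℂ) : ℂ × ℂ → EllCurve Λ₁ × EllCurve Λ₂ :=
  fun z => (curveProj Λ₁ z.1, curveProj Λ₂ z.2)

section Holomorphic

variable {V W : Type*} [NormedAddCommGroup V] [NormedSpace ℂ V]
  [NormedAddCommGroup W] [NormedSpace ℂ W] {X Y : Type*}

/-- `g`, near `z`, is a holomorphic local lift of `f : X → Y` to the coverings `p : V → X` and
`q : W → Y`. The complex structures of the quotients `X` and `Y` are those for which the coverings
are local biholomorphisms, so `g` is `f` written in local holomorphic coordinates. -/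
def IsLocalLift (p : V → X) (q : W → Y) (f : X → Y) (g : V → W) (z : V) : Prop :=
  AnalyticAt ℂ g z ∧ ∀ᶠ w in 𝓝 z, f (p w) = q (g w)

/-- `f` is a holomorphic immersion with respect to the complex structures induced by the
coverings `p` and `q`: in local coordinates it is holomorphic with injective differential. -/
def IsHolomorphicImmersion (p : V → X) (q : W → Y) (f : X → Y) : Prop :=
  ∀ z, ∃ g : V → W, IsLocalLift p q f g z ∧ Function.Injective (fderiv ℂ g z)

/-- `f` is a holomorphic submersion with respect to the complex structures induced by the
coverings `p` and `q`: in local coordinates it is holomorphic with surjective differential. -/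
def IsHolomorphicSubmersion (p : V → X) (q : W → Y) (f : X → Y) : Prop :=
  ∀ z, ∃ g : V → W, IsLocalLift p q f g z ∧ Function.Surjective (fderiv ℂ g z)

end Holomorphic

/-- `ι : ℂ / Λ → E₁ × E₂` is a holomorphic embedding: an injective holomorphic immersion (the
source being compact when `Λ` is a lattice). No compatibility with the group laws is required. -/
def IsHolomorphicEmbedding {Λ Λ₁ Λ₂ : Submodule ℤ ℂ}
    (ι : EllCurve Λ → EllCurve Λ₁ × EllCurve Λ₂) : Prop :=
  Function.Injective ι ∧ IsHolomorphicImmersion (curveProj Λ) (surfProj Λ₁ Λ₂) ι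

/-- `F ⊆ E₁ × E₂` is a (smooth) elliptic curve on the surface `E₁ × E₂`: the image of a
holomorphic embedding of an elliptic curve `ℂ / Λ`. -/
def IsEllipticCurveOn {Λ₁ Λ₂ : Submodule ℤ ℂ} (F : Set (EllCurve Λ₁ × EllCurve Λ₂)) : Prop :=
  ∃ Λ : Submodule ℤ ℂ, IsComplexLattice Λ ∧
    ∃ ι : EllCurve Λ → EllCurve Λ₁ × EllCurve Λ₂, IsHolomorphicEmbedding ι ∧ Set.range ι = F

/-- The map `t ↦ (a t + π₁(E₁), b t + π₁(E₂))`. -/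
def lineMap (Λ₁ Λ₂ : Submodule ℤ ℂ) (a b : ℂ) : ℂ → EllCurve Λ₁ × EllCurve Λ₂ :=
  fun t => surfProj Λ₁ Λ₂ (a * t, b * t)

/-- The group `a⁻¹ π₁(E₁) ∩ b⁻¹ π₁(E₂)` if `a, b ≠ 0`, the group `a⁻¹ π₁(E₁)` if `b = 0`, and the
group `b⁻¹ π₁(E₂)` if `a = 0`. -/
def slopePeriods (Λ₁ Λ₂ : Submodule ℤ ℂ) (a b : ℂ) : Submodule ℤ ℂ :=
  if a = 0 then b⁻¹ • Λ₂ else if b = 0 then a⁻¹ • Λ₁ else a⁻¹ • Λ₁ ⊓ b⁻¹ • Λ₂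

/-- The subgroup `a π₁(E₂) + b π₁(E₁)` of `ℂ`. -/
def basePeriods (Λ₁ Λ₂ : Submodule ℤ ℂ) (a b : ℂ) : Submodule ℤ ℂ := a • Λ₂ ⊔ b • Λ₁

theorem le_comap_basePeriods_left (Λ₁ Λ₂ : Submodule ℤ ℂ) (a b : ℂ) :
    Λ₁ ≤ (basePeriods Λ₁ Λ₂ a b).comap (LinearMap.mulLeft ℤ b) := fun _ hx =>
  Submodule.mem_sup_right (Submodule.smul_mem_pointwise_smul _ b _ hx)

theorem le_comap_basePeriods_right (Λ₁ Λ₂ : Submodule ℤ ℂ) (a b : ℂ) :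
    Λ₂ ≤ (basePeriods Λ₁ Λ₂ a b).comap (LinearMap.mulLeft ℤ a) := fun _ hx =>
  Submodule.mem_sup_left (Submodule.smul_mem_pointwise_smul _ a _ hx)

/-- The homomorphism `ψ : E₁ × E₂ → ℂ / (a π₁(E₂) + b π₁(E₁))`,
`ψ (u + π₁(E₁), v + π₁(E₂)) = b u - a v + a π₁(E₂) + b π₁(E₁)`. -/
def psi (Λ₁ Λ₂ : Submodule ℤ ℂ) (a b : ℂ) :
    EllCurve Λ₁ × EllCurve Λ₂ →+ EllCurve (basePeriods Λ₁ Λ₂ a b) :=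
  (((Submodule.mapQ Λ₁ _ (LinearMap.mulLeft ℤ b)
      (le_comap_basePeriods_left Λ₁ Λ₂ a b)).comp (LinearMap.fst ℤ _ _)) -
    ((Submodule.mapQ Λ₂ _ (LinearMap.mulLeft ℤ a)
      (le_comap_basePeriods_right Λ₁ Λ₂ a b)).comp (LinearMap.snd ℤ _ _))).toAddMonoidHom

theorem psi_surfProj (Λ₁ Λ₂ : Submodule ℤ ℂ) (a b u v : ℂ) :
    psi Λ₁ Λ₂ a b (surfProj Λ₁ Λ₂ (u, v)) =
      curveProj (basePeriods Λ₁ Λ₂ a b) (b * u - a * v) := rfl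

end

/-!
An elliptic curve `F` on `E₁ × E₂` is the image of a holomorphic immersion `ι` of some `ℂ / Λ`. Two
local lifts of `ι` to the universal coverings differ by a locally constant period, so their
differential is a well-defined entire function on `ℂ`. It is `Λ`-periodic, hence bounded, hence
constant by Liouville's theorem: `ι` is affine
(`IsHolomorphicImmersion.exists_eq_lineMap_add`). If `F` contains the origin, it is therefore the
image of a line, and injectivity of `ι` says that the periods of the line are exactly `Λ`.

Another slope vector of the same curve is a multiple of this one, because a line that is not
parallel to it meets only countably many points of the preimage of `F` in `ℂ²`
(`exists_mul_eq_of_range_lineMap_eq`). So the periods of every line with image `F` form a lattice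
`P`. Compactness of `ℂ / P` makes `ℂ → F` a quotient map, thus a covering with group `P` and simply
connected total space; this gives the fundamental group (`exists_mulEquiv_fundamentalGroup`).

When `a` and `b` are nonzero, `a π₁(E₂) + b π₁(E₁)` is a sum of two lattices whose intersection
`a b P` is again a lattice. The intersection has finite index in each of them, so the sum is discrete
(`IsComplexLattice.sup`). The kernel of `ψ` is found by solving `b u = a v` after a change of `u` and
`v` by periods (`surfProj_mem_range_lineMap_iff`), and the fibres are its cosets.
-/

/-! ### Lattices -/

theorem IsComplexLattice.isClosed {Λ : Submodule ℤ ℂ} (h : IsComplexLattice Λ) :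
    IsClosed (Λ : Set ℂ) := by
  obtain ⟨_, _⟩ := h
  exact AddSubgroup.isClosed_of_discrete (H := Λ.toAddSubgroup)

theorem IsComplexLattice.countable {Λ : Submodule ℤ ℂ} (h : IsComplexLattice Λ) :
    (Λ : Set ℂ).Countable := by
  obtain ⟨_, _⟩ := h
  exact Set.countable_coe_iff.mp (inferInstanceAs (Countable Λ))

theorem IsComplexLattice.nhdsWithin_eq_pure {Λ : Submodule ℤ ℂ} (h : IsComplexLattice Λ)
    {x : ℂ} (hx : x ∈ Λ) : 𝓝[(Λ : Set ℂ)] x = pure x := by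
  obtain ⟨hd, _⟩ := h
  exact isDiscrete_iff_nhdsWithin.mp ⟨hd⟩ x hx

/-- A continuous function with values in a lattice is locally constant. -/
theorem IsComplexLattice.eventually_eq_of_eventually_mem {V : Type*} [TopologicalSpace V]
    {Λ : Submodule ℤ ℂ} (hΛ : IsComplexLattice Λ) {h : V → ℂ} {z : V} (hc : ContinuousAt h z)
    (hm : ∀ᶠ w in 𝓝 z, h w ∈ Λ) : ∀ᶠ w in 𝓝 z, h w = h z := by
  have ht := tendsto_nhdsWithin_of_tendsto_nhds_of_eventually_within (s := (Λ : Set ℂ)) h hc hm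
  rw [hΛ.nhdsWithin_eq_pure hm.self_of_nhds] at ht
  exact Filter.tendsto_pure.mp ht

/-- A group between two lattices is a lattice. -/
theorem IsComplexLattice.of_le_of_le {Λ Λ' Λ'' : Submodule ℤ ℂ} (h : IsComplexLattice Λ)
    (h'' : IsComplexLattice Λ'') (h₁ : Λ ≤ Λ') (h₂ : Λ' ≤ Λ'') : IsComplexLattice Λ' := by
  obtain ⟨_, hs⟩ := h
  obtain ⟨hd, _⟩ := h''
  have hd' : DiscreteTopology Λ' := DiscreteTopology.of_subset hd h₂
  exact ⟨hd', ⟨top_le_iff.mp (hs.span_top.symm.le.trans (Submodule.span_mono h₁))⟩⟩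

/-- The preimage of a lattice under multiplication by a nonzero number is a lattice. -/
theorem IsComplexLattice.of_mem_iff_mul_mem {Λ Λ' : Submodule ℤ ℂ} (h : IsComplexLattice Λ)
    {c : ℂ} (hc : c ≠ 0) (hmem : ∀ t, t ∈ Λ' ↔ c * t ∈ Λ) : IsComplexLattice Λ' := by
  obtain ⟨_, _⟩ := h
  let e : ℂ ≃L[ℝ] ℂ :=
    (ContinuousLinearEquiv.unitsEquivAut ℂ (Units.mk0 c hc)).restrictScalars ℝ
  have he : Λ' = ZLattice.comap ℝ Λ (e : ℂ →ₗ[ℝ] ℂ) := by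
    ext t
    rw [hmem, mul_comm]
    exact Iff.rfl
  rw [he]
  exact ⟨inferInstance, inferInstance⟩

theorem mem_inv_smul_iff {Λ : Submodule ℤ ℂ} {c : ℂ} (hc : c ≠ 0) (t : ℂ) :
    t ∈ c⁻¹ • Λ ↔ c * t ∈ Λ :=
  Set.mem_inv_smul_set_iff₀ hc (Λ : Set ℂ) t

theorem zero_smul_submodule (Λ : Submodule ℤ ℂ) : (0 : ℂ) • Λ = ⊥ :=
  (Submodule.eq_bot_iff _).mpr fun _ hx => by
    obtain ⟨y, -, rfl⟩ := hx
    exact zero_mul y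

theorem IsComplexLattice.smul {Λ : Submodule ℤ ℂ} (h : IsComplexLattice Λ)
    {c : ℂ} (hc : c ≠ 0) : IsComplexLattice (c • Λ) :=
  h.of_mem_iff_mul_mem (inv_ne_zero hc) fun t => by
    simpa using mem_inv_smul_iff (Λ := Λ) (inv_ne_zero hc) t

/-- A sublattice of a lattice has finite index. -/
theorem IsComplexLattice.exists_nsmul_mem {Λ Λ' : Submodule ℤ ℂ} (h : IsComplexLattice Λ)
    (h' : IsComplexLattice Λ') (hle : Λ ≤ Λ') :
    ∃ n : ℕ, n ≠ 0 ∧ ∀ x ∈ Λ', (n : ℂ) * x ∈ Λ := by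
  obtain ⟨_, _⟩ := h
  obtain ⟨_, _⟩ := h'
  have := ZLattice.module_free ℝ Λ'
  have := ZLattice.module_finite ℝ Λ'
  let N : Submodule ℤ Λ' := Λ.comap Λ'.subtype
  have hN : Module.finrank ℤ N = Module.finrank ℤ Λ' := by
    rw [(Submodule.comapSubtypeEquivOfLe hle).finrank_eq, ZLattice.rank ℝ Λ, ZLattice.rank ℝ Λ']
  have : Finite (Λ' ⧸ N) := Submodule.finiteQuotientOfFreeOfRankEq N hN
  refine ⟨Nat.card (Λ' ⧸ N), Nat.card_pos.ne', fun x hx => ?_⟩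
  have := AddSubgroup.nsmul_index_mem N.toAddSubgroup ⟨x, hx⟩
  rw [← nsmul_eq_mul]
  exact this

/-- The sum of two lattices with a common sublattice is a lattice: if `n` kills
`Λ ⧸ (Λ ⊓ Λ')`, the sum lies in `n⁻¹ Λ'`. -/
theorem IsComplexLattice.sup {Λ Λ' : Submodule ℤ ℂ} (h : IsComplexLattice Λ)
    (h' : IsComplexLattice Λ') (hinf : IsComplexLattice (Λ ⊓ Λ')) :
    IsComplexLattice (Λ ⊔ Λ') := by
  obtain ⟨n, hn, hmem⟩ := hinf.exists_nsmul_mem h inf_le_left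
  have hn' : (n : ℂ) ≠ 0 := Nat.cast_ne_zero.mpr hn
  refine h.of_le_of_le (h'.smul (inv_ne_zero hn')) le_sup_left (sup_le ?_ ?_)
  · exact fun x hx => (mem_inv_smul_iff hn' x).mpr (hmem x hx).2
  · intro x hx
    rw [mem_inv_smul_iff hn', ← nsmul_eq_mul]
    exact nsmul_mem hx n

/-! ### The coverings and the line maps -/

theorem curveProj_eq_iff {Λ : Submodule ℤ ℂ} {s t : ℂ} :
    curveProj Λ s = curveProj Λ t ↔ s - t ∈ Λ :=
  Submodule.Quotient.eq Λ

theorem curveProj_eq_zero_iff {Λ : Submodule ℤ ℂ} {t : ℂ} : curveProj Λ t = 0 ↔ t ∈ Λ :=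
  Submodule.Quotient.mk_eq_zero Λ

theorem curveProj_surjective (Λ : Submodule ℤ ℂ) : Function.Surjective (curveProj Λ) :=
  Submodule.Quotient.mk_surjective Λ

theorem continuous_curveProj (Λ : Submodule ℤ ℂ) : Continuous (curveProj Λ) :=
  Λ.continuous_mkQ

theorem surfProj_sub (Λ₁ Λ₂ : Submodule ℤ ℂ) (z w : ℂ × ℂ) :
    surfProj Λ₁ Λ₂ (z - w) = surfProj Λ₁ Λ₂ z - surfProj Λ₁ Λ₂ w := rfl

theorem surfProj_eq_iff {Λ₁ Λ₂ : Submodule ℤ ℂ} {z w : ℂ × ℂ} :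
    surfProj Λ₁ Λ₂ z = surfProj Λ₁ Λ₂ w ↔ z.1 - w.1 ∈ Λ₁ ∧ z.2 - w.2 ∈ Λ₂ := by
  simp only [surfProj, Prod.mk.injEq, curveProj_eq_iff]

theorem surfProj_surjective (Λ₁ Λ₂ : Submodule ℤ ℂ) : Function.Surjective (surfProj Λ₁ Λ₂) :=
  (curveProj_surjective Λ₁).prodMap (curveProj_surjective Λ₂)

theorem continuous_surfProj (Λ₁ Λ₂ : Submodule ℤ ℂ) : Continuous (surfProj Λ₁ Λ₂) :=
  (continuous_curveProj Λ₁).prodMap (continuous_curveProj Λ₂)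

theorem lineMap_zero (Λ₁ Λ₂ : Submodule ℤ ℂ) (a b : ℂ) : lineMap Λ₁ Λ₂ a b 0 = 0 := by
  simp only [lineMap, mul_zero]
  rfl

theorem lineMap_sub (Λ₁ Λ₂ : Submodule ℤ ℂ) (a b s t : ℂ) :
    lineMap Λ₁ Λ₂ a b (s - t) = lineMap Λ₁ Λ₂ a b s - lineMap Λ₁ Λ₂ a b t := by
  simp only [lineMap, mul_sub]
  rfl

theorem continuous_lineMap (Λ₁ Λ₂ : Submodule ℤ ℂ) (a b : ℂ) :
    Continuous (lineMap Λ₁ Λ₂ a b) :=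
  (continuous_surfProj Λ₁ Λ₂).comp (by fun_prop)

theorem mem_slopePeriods_iff {Λ₁ Λ₂ : Submodule ℤ ℂ} {a b : ℂ} (hab : (a, b) ≠ (0, 0)) (t : ℂ) :
    t ∈ slopePeriods Λ₁ Λ₂ a b ↔ a * t ∈ Λ₁ ∧ b * t ∈ Λ₂ := by
  unfold slopePeriods
  split_ifs with ha hb
  · have hb : b ≠ 0 := fun hb => hab (by rw [ha, hb])
    simp [mem_inv_smul_iff hb, ha]
  · simp [mem_inv_smul_iff ha, hb]
  · rw [Submodule.mem_inf, mem_inv_smul_iff ha, mem_inv_smul_iff hb]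

/-- `slopePeriods` is the group of periods of the line map. -/
theorem lineMap_eq_iff {Λ₁ Λ₂ : Submodule ℤ ℂ} {a b : ℂ} (hab : (a, b) ≠ (0, 0)) {s t : ℂ} :
    lineMap Λ₁ Λ₂ a b s = lineMap Λ₁ Λ₂ a b t ↔ s - t ∈ slopePeriods Λ₁ Λ₂ a b := by
  rw [mem_slopePeriods_iff hab, lineMap, lineMap, surfProj_eq_iff, mul_sub, mul_sub]

/-! ### Holomorphic maps from an elliptic curve to the surface -/

section LocalLift

variable {V : Type*} [NormedAddCommGroup V] [NormedSpace ℂ V] {X : Type*}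

theorem IsLocalLift.eventually {W Y : Type*} [NormedAddCommGroup W] [NormedSpace ℂ W]
    [CompleteSpace W]
    {p : V → X} {q : W → Y} {f : X → Y} {g : V → W} {z : V} (h : IsLocalLift p q f g z) :
    ∀ᶠ w in 𝓝 z, IsLocalLift p q f g w :=
  h.1.eventually_analyticAt.and h.2.eventually_nhds

/-- Two local lifts of the same map differ by a locally constant period, so that they have the same
differential. -/
theorem IsLocalLift.fderiv_eq {Λ₁ Λ₂ : Submodule ℤ ℂ} (hΛ₁ : IsComplexLattice Λ₁)
    (hΛ₂ : IsComplexLattice Λ₂) {p : V → X} {f : X → EllCurve Λ₁ × EllCurve Λ₂}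
    {g g' : V → ℂ × ℂ} {z : V} (h : IsLocalLift p (surfProj Λ₁ Λ₂) f g z)
    (h' : IsLocalLift p (surfProj Λ₁ Λ₂) f g' z) : fderiv ℂ g z = fderiv ℂ g' z := by
  have hm : ∀ᶠ w in 𝓝 z, (g w).1 - (g' w).1 ∈ Λ₁ ∧ (g w).2 - (g' w).2 ∈ Λ₂ := by
    filter_upwards [h.2, h'.2] with w hw hw'
    exact surfProj_eq_iff.mp (hw.symm.trans hw')
  have hg := h.1.continuousAt
  have hg' := h'.1.continuousAt
  have h₁ := hΛ₁.eventually_eq_of_eventually_mem (hg.fst.sub hg'.fst) (hm.mono fun _ hw => hw.1)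
  have h₂ := hΛ₂.eventually_eq_of_eventually_mem (hg.snd.sub hg'.snd) (hm.mono fun _ hw => hw.2)
  have heq : g =ᶠ[𝓝 z] fun w => g' w + (g z - g' z) := by
    filter_upwards [h₁, h₂] with w hw₁ hw₂
    have : g w - g' w = g z - g' z := Prod.ext hw₁ hw₂
    rw [← this]
    abel
  rw [heq.fderiv_eq, fderiv_add_const]

/-- Precomposing a local lift at `z + l` with the translation by a period `l` gives a local lift
at `z`. -/
theorem IsLocalLift.comp_add_right {Λ : Submodule ℤ ℂ} {W Y : Type*} [NormedAddCommGroup W]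
    [NormedSpace ℂ W] {q : W → Y} {f : EllCurve Λ → Y} {g : ℂ → W} {z l : ℂ} (hl : l ∈ Λ)
    (h : IsLocalLift (curveProj Λ) q f g (z + l)) :
    IsLocalLift (curveProj Λ) q f (fun w => g (w + l)) z := by
  have ht : Filter.Tendsto (fun w => w + l) (𝓝 z) (𝓝 (z + l)) :=
    (continuous_add_const l).tendsto z
  refine ⟨AnalyticAt.fun_comp (f := fun w => w + l) h.1 (by fun_prop), ?_⟩
  filter_upwards [ht.eventually h.2] with w hw
  rw [← hw, curveProj_eq_iff.mpr (by simpa using hl : w + l - w ∈ Λ)]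

end LocalLift

/-- The differential of a holomorphic map from an elliptic curve to the surface, read on the
universal coverings, is an entire `Λ`-periodic function, hence constant by Liouville's theorem.
So the map is affine. -/
theorem IsHolomorphicImmersion.exists_eq_lineMap_add {Λ Λ₁ Λ₂ : Submodule ℤ ℂ}
    (hΛ : IsComplexLattice Λ) (hΛ₁ : IsComplexLattice Λ₁) (hΛ₂ : IsComplexLattice Λ₂)
    {ι : EllCurve Λ → EllCurve Λ₁ × EllCurve Λ₂}
    (hι : IsHolomorphicImmersion (curveProj Λ) (surfProj Λ₁ Λ₂) ι) :
    ∃ (a b : ℂ) (x : EllCurve Λ₁ × EllCurve Λ₂), (a, b) ≠ (0, 0) ∧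
      ∀ t, ι (curveProj Λ t) = lineMap Λ₁ Λ₂ a b t + x := by
  choose g hg hinj using hι
  let D : ℂ → ℂ →L[ℂ] ℂ × ℂ := fun z => fderiv ℂ (g z) z
  have hD (z : ℂ) : D =ᶠ[𝓝 z] fderiv ℂ (g z) := by
    filter_upwards [(hg z).eventually] with w hw
    exact (hg w).fderiv_eq hΛ₁ hΛ₂ hw
  have hdiff : Differentiable ℂ D := fun z =>
    ((hD z).differentiableAt_iff).mpr (hg z).1.fderiv.differentiableAt
  have hper (z l : ℂ) (hl : l ∈ Λ) : D (z + l) = D z := by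
    have := ((hg (z + l)).comp_add_right hl).fderiv_eq hΛ₁ hΛ₂ (hg z)
    rwa [fderiv_comp_add_right] at this
  have hconst (z : ℂ) : D z = D 0 := by
    obtain ⟨_, _⟩ := hΛ
    exact hdiff.apply_eq_apply_of_bounded
      (IsZLattice.isCompact_range_of_periodic Λ D hdiff.continuous hper).isBounded z 0
  have hloc : IsLocallyConstant fun z => ι (curveProj Λ z) - surfProj Λ₁ Λ₂ (D 0 z) := by
    refine (IsLocallyConstant.iff_eventually_eq _).mpr fun z => ?_
    obtain ⟨r, hr, hball⟩ := Metric.eventually_nhds_iff_ball.mp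
      ((hD z).and (hg z).eventually)
    filter_upwards [Metric.ball_mem_nhds z hr] with w hw
    have hd (u : ℂ) (hu : u ∈ Metric.ball z r) : HasFDerivAt (g z) (D 0) u := by
      rw [← hconst u, (hball u hu).1]
      exact (hball u hu).2.1.differentiableAt.hasFDerivAt
    have key : g z w - D 0 w = g z z - D 0 z := by
      refine Metric.isOpen_ball.is_const_of_fderiv_eq_zero (𝕜 := ℂ)
        (f := fun u => g z u - D 0 u) (convex_ball z r).isPreconnected
        (fun u hu => ((hd u hu).sub (D 0).hasFDerivAt).differentiableAt.differentiableWithinAt)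
        (fun u hu => ?_) hw (Metric.mem_ball_self hr)
      exact ((hd u hu).sub (D 0).hasFDerivAt).fderiv.trans (sub_self _)
    have hz := (hball z (Metric.mem_ball_self hr)).2.2.self_of_nhds
    rw [(hball w hw).2.2.self_of_nhds, hz, ← surfProj_sub, ← surfProj_sub, key]
  refine ⟨(D 0 1).1, (D 0 1).2, ι (curveProj Λ 0), fun h0 => ?_, fun t => ?_⟩
  · have : D 0 1 = 0 := h0
    exact one_ne_zero (hinj 0 (this.trans (map_zero (D 0)).symm))
  · have h1 := hloc.apply_eq_of_preconnectedSpace t 0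
    have h2 : D 0 t = ((D 0 1).1 * t, (D 0 1).2 * t) := by
      have : D 0 t = t • D 0 1 := by rw [← map_smul, smul_eq_mul, mul_one]
      rw [this, mul_comm _ t, mul_comm _ t]
      rfl
    have h3 : surfProj Λ₁ Λ₂ (D 0 0) = 0 := by rw [map_zero]; rfl
    simp only [h3, sub_zero] at h1
    rw [← h1, lineMap, ← h2]
    abel

/-! ### Slope vectors -/

/-- An elliptic curve through the origin is the image of a line whose group of periods is a
lattice. -/
theorem IsEllipticCurveOn.exists_slope {Λ₁ Λ₂ : Submodule ℤ ℂ}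
    (hΛ₁ : IsComplexLattice Λ₁) (hΛ₂ : IsComplexLattice Λ₂)
    {F : Set (EllCurve Λ₁ × EllCurve Λ₂)} (hF : IsEllipticCurveOn F) (h0 : 0 ∈ F) :
    ∃ a b : ℂ, (a, b) ≠ (0, 0) ∧ F = Set.range (lineMap Λ₁ Λ₂ a b) ∧
      IsComplexLattice (slopePeriods Λ₁ Λ₂ a b) := by
  obtain ⟨Λ, hΛ, ι, ⟨hinj, himm⟩, rfl⟩ := hF
  obtain ⟨a, b, x, hab, hι⟩ := himm.exists_eq_lineMap_add hΛ hΛ₁ hΛ₂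
  obtain ⟨y, hy⟩ := h0
  obtain ⟨t₀, rfl⟩ := curveProj_surjective Λ y
  have hι' (t : ℂ) : ι (curveProj Λ t) = lineMap Λ₁ Λ₂ a b (t - t₀) := by
    rw [hι] at hy
    rw [hι, lineMap_sub, eq_neg_of_add_eq_zero_right hy, sub_eq_add_neg]
  refine ⟨a, b, hab, ?_, ?_⟩
  · rw [← (curveProj_surjective Λ).range_comp,
      ← (Equiv.subRight t₀).surjective.range_comp (lineMap Λ₁ Λ₂ a b)]
    exact congrArg Set.range (funext hι')
  · have : slopePeriods Λ₁ Λ₂ a b = Λ := by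
      ext t
      have h1 := lineMap_eq_iff (Λ₁ := Λ₁) (Λ₂ := Λ₂) hab (s := t + t₀ - t₀) (t := t₀ - t₀)
      rw [← hι', ← hι', hinj.eq_iff, curveProj_eq_iff] at h1
      simpa using h1.symm
    rwa [this]

/-- Two slope vectors of the same curve are proportional: otherwise a fixed nonzero multiple of
every `t : ℂ` would lie in the countable set `b' π₁(E₁) - a' π₁(E₂)`. -/
theorem exists_mul_eq_of_range_lineMap_eq {Λ₁ Λ₂ : Submodule ℤ ℂ}
    (hΛ₁ : IsComplexLattice Λ₁) (hΛ₂ : IsComplexLattice Λ₂) {a b a' b' : ℂ}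
    (hab : (a, b) ≠ (0, 0)) (hab' : (a', b') ≠ (0, 0))
    (h : Set.range (lineMap Λ₁ Λ₂ a b) = Set.range (lineMap Λ₁ Λ₂ a' b')) :
    ∃ c : ℂ, c ≠ 0 ∧ a = a' * c ∧ b = b' * c := by
  have hdet : b' * a - a' * b = 0 := by
    by_contra hne
    have hcount : (Set.image2 (fun x y => b' * x - a' * y) (Λ₁ : Set ℂ) (Λ₂ : Set ℂ)).Countable :=
      hΛ₁.countable.image2 hΛ₂.countable _
    refine not_countable_complex ((hcount.preimage (mul_right_injective₀ hne)).mono ?_)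
    intro t _
    obtain ⟨s, hs⟩ : lineMap Λ₁ Λ₂ a b t ∈ Set.range (lineMap Λ₁ Λ₂ a' b') := h ▸ ⟨t, rfl⟩
    obtain ⟨h₁, h₂⟩ := surfProj_eq_iff.mp hs.symm
    exact ⟨_, h₁, _, h₂, by ring⟩
  have hdet' : b' * a = a' * b := sub_eq_zero.mp hdet
  by_cases ha' : a' = 0
  · have hb' : b' ≠ 0 := fun hb' => hab' (by rw [ha', hb'])
    have ha : a = 0 := by simpa [ha', hb'] using hdet'
    refine ⟨b / b', div_ne_zero (fun hb => hab (by rw [ha, hb])) hb', by simp [ha, ha'], ?_⟩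
    field_simp
  · have hb : b = b' * (a / a') := by
      field_simp
      rw [hdet', mul_comm]
    refine ⟨a / a', div_ne_zero (fun ha => hab ?_) ha', by field_simp, hb⟩
    rw [hb, ha]
    simp

theorem isComplexLattice_slopePeriods {Λ₁ Λ₂ : Submodule ℤ ℂ}
    (hΛ₁ : IsComplexLattice Λ₁) (hΛ₂ : IsComplexLattice Λ₂)
    {F : Set (EllCurve Λ₁ × EllCurve Λ₂)} (hF : IsEllipticCurveOn F) (h0 : 0 ∈ F) {a b : ℂ}
    (hab : (a, b) ≠ (0, 0)) (h : F = Set.range (lineMap Λ₁ Λ₂ a b)) :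
    IsComplexLattice (slopePeriods Λ₁ Λ₂ a b) := by
  obtain ⟨a', b', hab', h', hP⟩ := hF.exists_slope hΛ₁ hΛ₂ h0
  obtain ⟨c, hc, rfl, rfl⟩ := exists_mul_eq_of_range_lineMap_eq hΛ₁ hΛ₂ hab hab' (h.symm.trans h')
  refine hP.of_mem_iff_mul_mem hc fun t => ?_
  rw [mem_slopePeriods_iff hab, mem_slopePeriods_iff hab', mul_assoc, mul_assoc]

/-- The translate by `x` of the line map descends to the quotient by its periods. -/
theorem exists_isHolomorphicEmbedding_lineMap_add {Λ₁ Λ₂ : Submodule ℤ ℂ} {a b : ℂ}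
    (hab : (a, b) ≠ (0, 0)) (x : EllCurve Λ₁ × EllCurve Λ₂) :
    ∃ ι : EllCurve (slopePeriods Λ₁ Λ₂ a b) → EllCurve Λ₁ × EllCurve Λ₂,
      IsHolomorphicEmbedding ι ∧
      ∀ t, ι (curveProj (slopePeriods Λ₁ Λ₂ a b) t) = lineMap Λ₁ Λ₂ a b t + x := by
  set P := slopePeriods Λ₁ Λ₂ a b
  let ι : EllCurve P → EllCurve Λ₁ × EllCurve Λ₂ :=
    fun y => lineMap Λ₁ Λ₂ a b (Function.surjInv (curveProj_surjective P) y) + x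
  have hι (t : ℂ) : ι (curveProj P t) = lineMap Λ₁ Λ₂ a b t + x := by
    have := curveProj_eq_iff.mp (Function.surjInv_eq (curveProj_surjective P) (curveProj P t))
    exact congrArg (· + x) ((lineMap_eq_iff hab).mpr this)
  refine ⟨ι, ⟨fun y y' hyy => ?_, fun z => ?_⟩, hι⟩
  · obtain ⟨s, rfl⟩ := curveProj_surjective P y
    obtain ⟨t, rfl⟩ := curveProj_surjective P y'
    rw [hι, hι, add_left_inj, lineMap_eq_iff hab] at hyy
    exact curveProj_eq_iff.mpr hyy
  · obtain ⟨v, rfl⟩ := surfProj_surjective Λ₁ Λ₂ x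
    have hd : HasFDerivAt (fun t : ℂ => (a * t, b * t) + v)
        (ContinuousLinearMap.toSpanSingleton ℂ (a, b)) z := by
      have h : (fun t : ℂ => (a * t, b * t) + v) =
          fun t => ContinuousLinearMap.toSpanSingleton ℂ (a, b) t + v := by
        funext t
        rw [ContinuousLinearMap.toSpanSingleton_apply, Prod.smul_mk, smul_eq_mul, smul_eq_mul,
          mul_comm t, mul_comm t]
      rw [h]
      exact (ContinuousLinearMap.toSpanSingleton ℂ (a, b)).hasFDerivAt.add_const v
    refine ⟨fun t => (a * t, b * t) + v, ⟨by fun_prop, .of_forall hι⟩, ?_⟩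
    rw [hd.fderiv]
    intro s t hst
    exact smul_left_injective ℂ hab hst

/-! ### The fundamental group -/

/-- The fundamental group of a quotient of `ℂ` by a discrete group of translations. -/
theorem exists_mulEquiv_fundamentalGroup {X : Type*} [TopologicalSpace X] {q : ℂ → X}
    {P : Submodule ℤ ℂ} (hP : DiscreteTopology P) (hq : IsQuotientMap q)
    (hqP : ∀ s t, q s = q t ↔ s - t ∈ P) {x : X} (hx : q 0 = x) :
    ∃ φ : Multiplicative P ≃* FundamentalGroup X x, ∀ m : P, ∃ γ : Path x x,
      (∀ s : unitInterval, γ s = q (((s : ℝ) : ℂ) * (m : ℂ))) ∧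
      φ (Multiplicative.ofAdd m) =
        FundamentalGroup.fromPath (Path.Homotopic.Quotient.mk γ) := by
  have hcov : IsAddQuotientCoveringMap q P.toAddSubgroup :=
    hq.isAddQuotientCoveringMap_of_addSubgroup P.toAddSubgroup ⟨hP⟩ fun {s t} => by
      rw [eq_comm, hqP, sub_eq_add_neg]
      rfl
  let e : q ⁻¹' {x} := ⟨0, hx⟩
  let ψ : FundamentalGroup X x ≃* (Multiplicative P)ᵐᵒᵖ := hcov.fundamentalGroupEquiv e
  refine ⟨MulOpposite.opMulEquiv.trans ψ.symm, fun m => ?_⟩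
  have hm : q m = x := by rw [← hx, hqP]; simp
  let Γ : Path (0 : ℂ) (m : ℂ) :=
    { toFun := fun s => ((s : ℝ) : ℂ) * (m : ℂ)
      continuous_toFun := by fun_prop
      source' := by simp
      target' := by simp }
  let γ : Path x x := (Γ.map hq.continuous).cast hx.symm hm.symm
  refine ⟨γ, fun s => rfl, ?_⟩
  rw [MulEquiv.trans_apply, MulEquiv.symm_apply_eq]
  refine (hcov.fundamentalGroupToMulOpposite_apply_eq_Iff.mpr ?_).symm
  have := hcov.isCoveringMap.monodromy_eq_of_map_eq (γ := Path.Homotopic.Quotient.mk γ)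
    (ex := e) (ey := ⟨m, hm⟩) (Path.Homotopic.Quotient.mk Γ) rfl
  refine Eq.trans ?_ (congrArg Subtype.val this).symm
  exact add_zero (m : ℂ)

theorem IsComplexLattice.compactSpace_ellCurve {Λ : Submodule ℤ ℂ} (h : IsComplexLattice Λ) :
    CompactSpace (EllCurve Λ) := by
  obtain ⟨_, _⟩ := h
  have := IsZLattice.isCompact_range_of_periodic Λ (curveProj Λ) (continuous_curveProj Λ)
    fun z w hw => curveProj_eq_iff.mpr (by simpa using hw)
  rw [(curveProj_surjective Λ).range_eq] at this
  exact ⟨this⟩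

theorem IsComplexLattice.t2Space_ellCurve {Λ : Submodule ℤ ℂ} (h : IsComplexLattice Λ) :
    T2Space (EllCurve Λ) := by
  have := h.isClosed
  infer_instance

/-- A line with a lattice of periods covers its image `F`: the induced map from `ℂ / P` to `F` is a
continuous bijection from a compact space to a Hausdorff space. -/
theorem isQuotientMap_lineMap {Λ₁ Λ₂ : Submodule ℤ ℂ}
    (hΛ₁ : IsComplexLattice Λ₁) (hΛ₂ : IsComplexLattice Λ₂) {a b : ℂ}
    (hab : (a, b) ≠ (0, 0)) (hP : IsComplexLattice (slopePeriods Λ₁ Λ₂ a b))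
    {F : Set (EllCurve Λ₁ × EllCurve Λ₂)} (hF : F = Set.range (lineMap Λ₁ Λ₂ a b)) :
    IsQuotientMap fun t => (⟨lineMap Λ₁ Λ₂ a b t, hF ▸ ⟨t, rfl⟩⟩ : F) := by
  have := hP.compactSpace_ellCurve
  have := hΛ₁.t2Space_ellCurve
  have := hΛ₂.t2Space_ellCurve
  set q : ℂ → F := fun t => ⟨lineMap Λ₁ Λ₂ a b t, hF ▸ ⟨t, rfl⟩⟩
  have hq : Continuous q := (continuous_lineMap Λ₁ Λ₂ a b).subtype_mk _
  let f : EllCurve (slopePeriods Λ₁ Λ₂ a b) → F := Quotient.lift q fun s t hst => by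
    have : curveProj (slopePeriods Λ₁ Λ₂ a b) s = curveProj _ t := Quotient.sound hst
    exact Subtype.ext ((lineMap_eq_iff hab).mpr (curveProj_eq_iff.mp this))
  have hf : Continuous f := hq.quotient_lift _
  have hsurj : Function.Surjective f := by
    rintro ⟨x, hx⟩
    obtain ⟨t, rfl⟩ : x ∈ Set.range (lineMap Λ₁ Λ₂ a b) := hF ▸ hx
    exact ⟨curveProj _ t, rfl⟩
  exact (hf.isClosedMap.isQuotientMap hf hsurj).comp
    (slopePeriods Λ₁ Λ₂ a b).isQuotientMap_mkQ

/-! ### The fibration -/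

theorem isComplexLattice_basePeriods {Λ₁ Λ₂ : Submodule ℤ ℂ}
    (hΛ₁ : IsComplexLattice Λ₁) (hΛ₂ : IsComplexLattice Λ₂) {a b : ℂ}
    (hab : (a, b) ≠ (0, 0)) (hP : IsComplexLattice (slopePeriods Λ₁ Λ₂ a b)) :
    IsComplexLattice (basePeriods Λ₁ Λ₂ a b) := by
  unfold basePeriods
  by_cases ha : a = 0
  · have hb : b ≠ 0 := fun hb => hab (by rw [ha, hb])
    rw [ha, zero_smul_submodule, bot_sup_eq]
    exact hΛ₁.smul hb
  by_cases hb : b = 0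
  · rw [hb, zero_smul_submodule, sup_bot_eq]
    exact hΛ₂.smul ha
  refine (hΛ₂.smul ha).sup (hΛ₁.smul hb) ?_
  -- `a Λ₂ ∩ b Λ₁ = a b (a⁻¹ Λ₁ ∩ b⁻¹ Λ₂)`
  refine hP.of_mem_iff_mul_mem (inv_ne_zero (mul_ne_zero ha hb)) fun t => ?_
  have ha' := mem_inv_smul_iff (Λ := Λ₂) (inv_ne_zero ha) t
  have hb' := mem_inv_smul_iff (Λ := Λ₁) (inv_ne_zero hb) t
  rw [inv_inv] at ha' hb'
  have h₁ : a * ((a * b)⁻¹ * t) = b⁻¹ * t := by field_simp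
  have h₂ : b * ((a * b)⁻¹ * t) = a⁻¹ * t := by field_simp
  rw [mem_slopePeriods_iff hab, Submodule.mem_inf, ha', hb', h₁, h₂, and_comm]

theorem mem_basePeriods_iff {Λ₁ Λ₂ : Submodule ℤ ℂ} {a b t : ℂ} :
    t ∈ basePeriods Λ₁ Λ₂ a b ↔ ∃ l₁ ∈ Λ₁, ∃ l₂ ∈ Λ₂, a * l₂ + b * l₁ = t := by
  rw [basePeriods, Submodule.mem_sup]
  constructor
  · rintro ⟨_, ⟨l₂, h₂, rfl⟩, _, ⟨l₁, h₁, rfl⟩, rfl⟩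
    exact ⟨l₁, h₁, l₂, h₂, rfl⟩
  · rintro ⟨l₁, h₁, l₂, h₂, rfl⟩
    exact ⟨_, ⟨l₂, h₂, rfl⟩, _, ⟨l₁, h₁, rfl⟩, rfl⟩

/-- The line of slope `(a, b)` is the locus where `b u - a v` is a period: subtracting periods from
`u` and `v` makes `b u - a v` vanish. -/
theorem surfProj_mem_range_lineMap_iff {Λ₁ Λ₂ : Submodule ℤ ℂ} {a b : ℂ}
    (hab : (a, b) ≠ (0, 0)) (u v : ℂ) :
    surfProj Λ₁ Λ₂ (u, v) ∈ Set.range (lineMap Λ₁ Λ₂ a b) ↔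
      b * u - a * v ∈ basePeriods Λ₁ Λ₂ a b := by
  rw [mem_basePeriods_iff]
  constructor
  · rintro ⟨t, ht⟩
    obtain ⟨h₁, h₂⟩ := surfProj_eq_iff.mp ht.symm
    exact ⟨_, h₁, _, neg_mem h₂, by ring⟩
  · rintro ⟨l₁, h₁, l₂, h₂, h⟩
    suffices ∃ t, u - l₁ = a * t ∧ v + l₂ = b * t by
      obtain ⟨t, hu, hv⟩ := this
      refine ⟨t, surfProj_eq_iff.mpr ⟨?_, ?_⟩⟩
      · rw [← hu]; simpa using h₁
      · rw [← hv]; simpa using h₂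
    have hdet : b * (u - l₁) = a * (v + l₂) := by linear_combination -h
    by_cases ha : a = 0
    · have hb : b ≠ 0 := fun hb => hab (by rw [ha, hb])
      refine ⟨(v + l₂) / b, ?_, by field_simp⟩
      simpa [ha, hb] using hdet
    · refine ⟨(u - l₁) / a, by field_simp, ?_⟩
      field_simp
      rw [hdet, mul_comm]

theorem range_lineMap_eq_ker_psi {Λ₁ Λ₂ : Submodule ℤ ℂ} {a b : ℂ} (hab : (a, b) ≠ (0, 0)) :
    Set.range (lineMap Λ₁ Λ₂ a b) =
      ((psi Λ₁ Λ₂ a b).ker : Set (EllCurve Λ₁ × EllCurve Λ₂)) := by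
  ext x
  obtain ⟨⟨u, v⟩, rfl⟩ := surfProj_surjective Λ₁ Λ₂ x
  rw [surfProj_mem_range_lineMap_iff hab, SetLike.mem_coe, AddMonoidHom.mem_ker, psi_surfProj,
    curveProj_eq_zero_iff]

theorem exists_mul_sub_mul_eq {a b : ℂ} (hab : (a, b) ≠ (0, 0)) (t : ℂ) :
    ∃ u v : ℂ, b * u - a * v = t := by
  by_cases ha : a = 0
  · have hb : b ≠ 0 := fun hb => hab (by rw [ha, hb])
    exact ⟨t / b, 0, by field_simp; simp⟩
  · exact ⟨0, -t / a, by field_simp; ring⟩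

theorem psi_surjective {Λ₁ Λ₂ : Submodule ℤ ℂ} {a b : ℂ} (hab : (a, b) ≠ (0, 0)) :
    Function.Surjective (psi Λ₁ Λ₂ a b) := by
  intro y
  obtain ⟨t, rfl⟩ := curveProj_surjective _ y
  obtain ⟨u, v, rfl⟩ := exists_mul_sub_mul_eq hab t
  exact ⟨surfProj Λ₁ Λ₂ (u, v), psi_surfProj Λ₁ Λ₂ a b u v⟩

theorem isHolomorphicSubmersion_psi {Λ₁ Λ₂ : Submodule ℤ ℂ} {a b : ℂ} (hab : (a, b) ≠ (0, 0)) :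
    IsHolomorphicSubmersion (surfProj Λ₁ Λ₂) (curveProj (basePeriods Λ₁ Λ₂ a b))
      (psi Λ₁ Λ₂ a b) := by
  intro z
  let L : ℂ × ℂ →L[ℂ] ℂ :=
    b • ContinuousLinearMap.fst ℂ ℂ ℂ - a • ContinuousLinearMap.snd ℂ ℂ ℂ
  refine ⟨L, ⟨L.analyticAt z, .of_forall fun w => psi_surfProj Λ₁ Λ₂ a b w.1 w.2⟩, ?_⟩
  rw [L.fderiv]
  intro t
  obtain ⟨u, v, rfl⟩ := exists_mul_sub_mul_eq hab t
  exact ⟨(u, v), rfl⟩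

theorem AddMonoidHom.preimage_singleton_eq_image_add_ker {G H : Type*} [AddGroup G] [AddGroup H]
    (f : G →+ H) (x : G) : f ⁻¹' {f x} = (fun y => y + x) '' (f.ker : Set G) := by
  ext y
  constructor
  · intro hy
    refine ⟨y - x, ?_, sub_add_cancel y x⟩
    simpa [sub_eq_zero, AddMonoidHom.mem_ker] using hy
  · rintro ⟨k, hk, rfl⟩
    simpa [AddMonoidHom.mem_ker] using hk

theorem mainTheorem10 (Λ₁ Λ₂ : Submodule ℤ ℂ)
    (hΛ₁ : IsComplexLattice Λ₁) (hΛ₂ : IsComplexLattice Λ₂)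
    (F : Set (EllCurve Λ₁ × EllCurve Λ₂)) (hF : IsEllipticCurveOn F)
    (h0 : (0 : EllCurve Λ₁ × EllCurve Λ₂) ∈ F) :
    -- `F` is the image of a line through the origin with some slope vector
    (∃ a b : ℂ, (a, b) ≠ (0, 0) ∧ F = Set.range (lineMap Λ₁ Λ₂ a b)) ∧
    -- and for every slope vector of `F`
    (∀ a b : ℂ, (a, b) ≠ (0, 0) → F = Set.range (lineMap Λ₁ Λ₂ a b) →
      -- the periods of `t ↦ (a t, b t)` form the stated lattice, by which this map induces
      -- an isomorphism of `ℂ / slopePeriods` onto `F`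
      IsComplexLattice (slopePeriods Λ₁ Λ₂ a b) ∧
      (∃ ι : EllCurve (slopePeriods Λ₁ Λ₂ a b) → EllCurve Λ₁ × EllCurve Λ₂,
        IsHolomorphicEmbedding ι ∧ Set.range ι = F ∧
        ∀ t : ℂ, ι (curveProj (slopePeriods Λ₁ Λ₂ a b) t) = lineMap Λ₁ Λ₂ a b t) ∧
      -- this lattice is the fundamental group of `F`: a period `m` corresponds to
      -- the class of the loop `s ↦ (a s m, b s m)`, `0 ≤ s ≤ 1`
      (∃ φ : Multiplicative (slopePeriods Λ₁ Λ₂ a b) ≃* FundamentalGroup F ⟨0, h0⟩,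
        ∀ m : slopePeriods Λ₁ Λ₂ a b, ∃ γ : Path (⟨0, h0⟩ : F) ⟨0, h0⟩,
          (∀ s : unitInterval,
            (γ s : EllCurve Λ₁ × EllCurve Λ₂) = lineMap Λ₁ Λ₂ a b (((s : ℝ) : ℂ) * (m : ℂ))) ∧
          φ (Multiplicative.ofAdd m) =
            FundamentalGroup.fromPath (Path.Homotopic.Quotient.mk γ)) ∧
      -- `ψ` is a holomorphic fibration over an elliptic curve, given by the stated formula
      IsComplexLattice (basePeriods Λ₁ Λ₂ a b) ∧
      (∀ u v : ℂ, psi Λ₁ Λ₂ a b (surfProj Λ₁ Λ₂ (u, v)) =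
        curveProj (basePeriods Λ₁ Λ₂ a b) (b * u - a * v)) ∧
      Function.Surjective (psi Λ₁ Λ₂ a b) ∧
      IsHolomorphicSubmersion (surfProj Λ₁ Λ₂) (curveProj (basePeriods Λ₁ Λ₂ a b))
        (psi Λ₁ Λ₂ a b) ∧
      -- with kernel `F`
      F = ((psi Λ₁ Λ₂ a b).ker : Set (EllCurve Λ₁ × EllCurve Λ₂)) ∧
      F = {x | ∃ u v : ℂ, x = surfProj Λ₁ Λ₂ (u, v) ∧
        b * u - a * v ∈ basePeriods Λ₁ Λ₂ a b} ∧
      -- the fibres are the translates of `F`, and are elliptic curves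
      (∀ x : EllCurve Λ₁ × EllCurve Λ₂,
        psi Λ₁ Λ₂ a b ⁻¹' {psi Λ₁ Λ₂ a b x} = (fun y => y + x) '' F ∧
        IsEllipticCurveOn (psi Λ₁ Λ₂ a b ⁻¹' {psi Λ₁ Λ₂ a b x}))) := by

  obtain ⟨a₀, b₀, hab₀, hF₀, -⟩ := hF.exists_slope hΛ₁ hΛ₂ h0
  refine ⟨⟨a₀, b₀, hab₀, hF₀⟩, fun a b hab hFab => ?_⟩
  have hP := isComplexLattice_slopePeriods hΛ₁ hΛ₂ hF h0 hab hFab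
  have hker := hFab.trans (range_lineMap_eq_ker_psi hab)
  -- the translates of `F` are parametrized by the translates of the line map
  have htranslate (x : EllCurve Λ₁ × EllCurve Λ₂) :
      ∃ ι : EllCurve (slopePeriods Λ₁ Λ₂ a b) → EllCurve Λ₁ × EllCurve Λ₂,
        IsHolomorphicEmbedding ι ∧ Set.range ι = (fun y => y + x) '' F ∧
        ∀ t : ℂ, ι (curveProj (slopePeriods Λ₁ Λ₂ a b) t) = lineMap Λ₁ Λ₂ a b t + x := by
    obtain ⟨ι, hemb, hι⟩ := exists_isHolomorphicEmbedding_lineMap_add (Λ₁ := Λ₁) (Λ₂ := Λ₂) hab x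
    refine ⟨ι, hemb, ?_, hι⟩
    rw [← (curveProj_surjective _).range_comp, hFab, ← Set.range_comp]
    exact congrArg Set.range (funext hι)
  refine ⟨hP, ?_, ?_, isComplexLattice_basePeriods hΛ₁ hΛ₂ hab hP, psi_surfProj Λ₁ Λ₂ a b,
    psi_surjective hab, isHolomorphicSubmersion_psi hab, hker, ?_, fun x => ?_⟩
  · simpa using htranslate 0
  · obtain ⟨φ, hφ⟩ := exists_mulEquiv_fundamentalGroup hP.1
      (isQuotientMap_lineMap hΛ₁ hΛ₂ hab hP hFab)
      (fun s t => by rw [Subtype.mk.injEq, lineMap_eq_iff hab])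
      (Subtype.ext (lineMap_zero Λ₁ Λ₂ a b) : _ = (⟨0, h0⟩ : F))
    refine ⟨φ, fun m => ?_⟩
    obtain ⟨γ, hγ, hφγ⟩ := hφ m
    exact ⟨γ, fun s => congrArg Subtype.val (hγ s), hφγ⟩
  · ext x
    constructor
    · intro hx
      obtain ⟨⟨u, v⟩, rfl⟩ := surfProj_surjective Λ₁ Λ₂ x
      exact ⟨u, v, rfl, (surfProj_mem_range_lineMap_iff hab u v).mp (hFab ▸ hx)⟩
    · rintro ⟨u, v, rfl, huv⟩
      rw [hFab]
      exact (surfProj_mem_range_lineMap_iff hab u v).mpr huv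
  · have hfib : psi Λ₁ Λ₂ a b ⁻¹' {psi Λ₁ Λ₂ a b x} = (fun y => y + x) '' F := by
      rw [hker]
      exact (psi Λ₁ Λ₂ a b).preimage_singleton_eq_image_add_ker x
    obtain ⟨ι, hemb, hrange, -⟩ := htranslate x
    exact ⟨hfib, _, hP, ι, hemb, hrange.trans hfib.symm⟩
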